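/- Let $p,q$ be positive integers and let $(\overline M,\overline g,J)$ be a locally metallic Riemannian manifold, i.e. $(\overline M,\overline g)$ is a Riemannian manifold and $J$ is a smooth $(1,1)$-tensor field on $\overline M$ such that $J^2=pJ+qI$, $\overline g(JX,Y)=\overline g(X,JY)$ for all vector fields $X,Y$, and $\overline\nabla J=0$, where $\overline\nabla$ is the Levi-Civita connection of $\overline g$. Let $(M_T,g_1)$ and $(M_\perp,g_2)$ be Riemannian manifolds with $\dim M_\perp>0$, let $f:M_T\to(0,\infty)$ be smooth, and let $M=M_T\times_f M_\perp$ be the warped product, i.e. $M_T\times M_\perp$ with the metric $g=\pi_1^*g_1+(f\circ\pi_1)^2\,\pi_2^*g_2$, where $\pi_1,\pi_2$ are the two projections. Let $i:M\to\overline M$ be an isometric immersion which makes $M$ a semi-invariant submanifold of $\overline M$, i.e. $M_T$ is an invariant and $M_\perp$ is an anti-invariant submanifold of $\overline M$: identifying tangent vectors of $M$ with their images under $i_*$, for all $x\in M_T$ and $y\in M_\perp$, $J$ maps the tangent spaces of the leaf $M_T\times\{y\}$ into themselves and maps the tangent spaces of the leaf $\{x\}\times M_\perp$ into their orthogonal complements.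 For $X$ tangent to $M$ let $TX$ be the component of $JX$ tangent to $M$, and write $f$ also for $f\circ\pi_1$. Then $$TX(\ln f)=-\frac{q}{p}\,X(\ln f)$$ for every $X$ tangent to $M_T$ (i.e. every tangent vector $X$ of $M$ with $d\pi_2(X)=0$). Moreover, if $(\overline M,\overline g,J)$ is locally Golden (i.e. locally metallic with $p=q=1$), then $TX(\ln f)=-X(\ln f)$ for all such $X$. -/

import Mathlib

open Bundle
open scoped Manifold ContDiff

noncomputable section

section Ambient

variable {E : Type*} [NormedAddCommGroup E] [NormedSpace ℝ E] [FiniteDimensional ℝ E]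
  {H : Type*} [TopologicalSpace H] {I : ModelWithCorners ℝ E H}
  {M : Type*} [TopologicalSpace M] [ChartedSpace H M] [IsManifold I ∞ M]
  [RiemannianBundle (fun x : M ↦ TangentSpace I x)]
  [IsContMDiffRiemannianBundle I ∞ E (fun x : M ↦ TangentSpace I x)]

/-- `∇` is the Levi-Civita connection of the Riemannian manifold `M`: it is compatible with the
metric and torsion-free. -/
def IsLeviCivita (nabla : CovariantDerivative I E (fun x : M ↦ TangentSpace I x)) : Prop :=
  haveI := FiniteDimensional.complete ℝ E
  nabla.IsMetricCompatible ∧ nabla.torsion = 0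

/-- The `(1,1)`-tensor field `J` is parallel: `(∇_v J) Y = ∇_v (J Y) - J (∇_v Y)` vanishes for
every tangent vector `v` and every vector field `Y` differentiable at the base point of `v`.
(In Mathlib `nabla Y x v` is `∇_v Y` at `x`.) -/
def IsParallelTensor (nabla : CovariantDerivative I E (fun x : M ↦ TangentSpace I x))
    (J : ∀ x : M, TangentSpace I x →L[ℝ] TangentSpace I x) : Prop :=
  ∀ (x : M) (Y : ∀ x : M, TangentSpace I x),
    MDifferentiableAt I (I.prod 𝓘(ℝ, E)) (fun y ↦ TotalSpace.mk' E y (Y y)) x →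
    ∀ v : TangentSpace I x, nabla (fun y ↦ J y (Y y)) x v - J x (nabla Y x v) = 0

/-- `(M, g, J)` is a metallic Riemannian manifold with parameters `p`, `q`: `J` is a smooth
`(1,1)`-tensor field with `J² = p J + q I`, and the Riemannian metric is `J`-compatible. -/
structure IsMetallicRiemannian (p q : ℕ)
    (J : ∀ x : M, TangentSpace I x →L[ℝ] TangentSpace I x) : Prop where
  contMDiff : ContMDiff I (I.prod 𝓘(ℝ, E →L[ℝ] E)) ∞
    (fun x ↦ TotalSpace.mk' (E →L[ℝ] E)
      (E := fun x : M ↦ TangentSpace I x →L[ℝ] TangentSpace I x) x (J x))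
  pos_left : 0 < p
  pos_right : 0 < q
  sq_eq : ∀ (x : M) (v : TangentSpace I x), J x (J x v) = (p : ℝ) • J x v + (q : ℝ) • v
  compatible : ∀ (x : M) (v w : TangentSpace I x), inner ℝ (J x v) w = inner ℝ v (J x w)

/-- `(M, g, J)` is a locally metallic Riemannian manifold: it is a metallic Riemannian manifold and
`J` is parallel with respect to the Levi-Civita connection. -/
def IsLocallyMetallic (p q : ℕ) (J : ∀ x : M, TangentSpace I x →L[ℝ] TangentSpace I x) : Prop :=
  IsMetallicRiemannian p q J ∧
    ∃ nabla : CovariantDerivative I E (fun x : M ↦ TangentSpace I x),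
      IsLeviCivita nabla ∧ IsParallelTensor nabla J

/-- `(M, g, J)` is a locally Golden Riemannian manifold. -/
def IsLocallyGolden (J : ∀ x : M, TangentSpace I x →L[ℝ] TangentSpace I x) : Prop :=
  IsLocallyMetallic 1 1 J

end Ambient

section Submanifold

variable {E : Type*} [NormedAddCommGroup E] [NormedSpace ℝ E]
  {H : Type*} [TopologicalSpace H] (I : ModelWithCorners ℝ E H)
  {M : Type*} [TopologicalSpace M] [ChartedSpace H M]
  {E' : Type*} [NormedAddCommGroup E'] [NormedSpace ℝ E']
  {H' : Type*} [TopologicalSpace H'] (I' : ModelWithCorners ℝ E' H')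
  {N : Type*} [TopologicalSpace N] [ChartedSpace H' N]

/-- `i : N → M` is a smooth immersion of finite-dimensional manifolds: it is smooth and its
differential is injective at every point. -/
structure IsSmoothImmersion (i : N → M) : Prop where
  contMDiff : ContMDiff I' I ∞ i
  injective : ∀ z : N, Function.Injective (mfderiv I' I i z)

/-- The tangent space of the immersed submanifold `i : N → M` at `z`, as a subspace of the tangent
space of `M` at `i z`. -/
def imageTangent (i : N → M) (z : N) : Submodule ℝ (TangentSpace I (i z)) :=
  LinearMap.range (mfderiv I' I i z).toLinearMap

/-- `i : N → M` is an invariant submanifold: `J (T_z N) ⊆ T_z N` for every `z`. -/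
def IsInvariantSubmanifold (J : ∀ x : M, TangentSpace I x →L[ℝ] TangentSpace I x) (i : N → M) :
    Prop :=
  ∀ z : N, ∀ v ∈ imageTangent I I' i z, J (i z) v ∈ imageTangent I I' i z

variable [RiemannianBundle (fun x : M ↦ TangentSpace I x)]

/-- `i : N → M` is an anti-invariant submanifold: `J (T_z N) ⊆ (T_z N)ᗮ` for every `z`. -/
def IsAntiInvariantSubmanifold (J : ∀ x : M, TangentSpace I x →L[ℝ] TangentSpace I x)
    (i : N → M) : Prop :=
  ∀ z : N, ∀ v ∈ imageTangent I I' i z, J (i z) v ∈ (imageTangent I I' i z)ᗮ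

instance imageTangent_finiteDimensional [FiniteDimensional ℝ E'] (i : N → M) (z : N) :
    FiniteDimensional ℝ (imageTangent I I' i z) :=
  haveI : FiniteDimensional ℝ (TangentSpace I' z) := inferInstanceAs (FiniteDimensional ℝ E')
  inferInstanceAs (FiniteDimensional ℝ (LinearMap.range (mfderiv I' I i z).toLinearMap))

/-- The operator `T` of an immersed submanifold: `T X` is the tangential component `(J X)ᵀ` of
`J X`, where tangent vectors of `N` are identified with their images under the differential of the
immersion `i`. -/
def tangentialOperator [FiniteDimensional ℝ E']
    (J : ∀ x : M, TangentSpace I x →L[ℝ] TangentSpace I x) {i : N → M}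
    (hi : IsSmoothImmersion I I' i) (z : N) : TangentSpace I' z →ₗ[ℝ] TangentSpace I' z :=
  (LinearEquiv.ofInjective (mfderiv I' I i z).toLinearMap (hi.injective z)).symm.toLinearMap ∘ₗ
    (imageTangent I I' i z).orthogonalProjectionOnto.toLinearMap ∘ₗ
      (J (i z)).toLinearMap ∘ₗ (mfderiv I' I i z).toLinearMap

end Submanifold

section WarpedProduct

variable {E : Type*} [NormedAddCommGroup E] [NormedSpace ℝ E]
  {H : Type*} [TopologicalSpace H] (I : ModelWithCorners ℝ E H)
  {M : Type*} [TopologicalSpace M] [ChartedSpace H M]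
  [RiemannianBundle (fun x : M ↦ TangentSpace I x)]
  {E₁ : Type*} [NormedAddCommGroup E₁] [NormedSpace ℝ E₁]
  {H₁ : Type*} [TopologicalSpace H₁] (I₁ : ModelWithCorners ℝ E₁ H₁)
  {M₁ : Type*} [TopologicalSpace M₁] [ChartedSpace H₁ M₁]
  [RiemannianBundle (fun x : M₁ ↦ TangentSpace I₁ x)]
  {E₂ : Type*} [NormedAddCommGroup E₂] [NormedSpace ℝ E₂]
  {H₂ : Type*} [TopologicalSpace H₂] (I₂ : ModelWithCorners ℝ E₂ H₂)
  {M₂ : Type*} [TopologicalSpace M₂] [ChartedSpace H₂ M₂]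
  [RiemannianBundle (fun x : M₂ ↦ TangentSpace I₂ x)]

/-- The warped product metric `π₁^* g₁ + (f ∘ π₁)² π₂^* g₂` on `M₁ × M₂`. -/
def warpedMetric (f : M₁ → ℝ) (z : M₁ × M₂) (u v : TangentSpace (I₁.prod I₂) z) : ℝ :=
  inner ℝ (mfderiv (I₁.prod I₂) I₁ Prod.fst z u) (mfderiv (I₁.prod I₂) I₁ Prod.fst z v) +
    f z.1 ^ 2 *
      inner ℝ (mfderiv (I₁.prod I₂) I₂ Prod.snd z u) (mfderiv (I₁.prod I₂) I₂ Prod.snd z v)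

/-- The map `i` is isometric from the warped product `M₁ ×_f M₂` to the Riemannian manifold `M`:
the metric induced by `i` is the warped product metric. -/
def IsWarpedProductIsometric (f : M₁ → ℝ) (i : M₁ × M₂ → M) : Prop :=
  ∀ (z : M₁ × M₂) (u v : TangentSpace (I₁.prod I₂) z),
    inner ℝ (mfderiv (I₁.prod I₂) I i z u) (mfderiv (I₁.prod I₂) I i z v) =
      warpedMetric I₁ I₂ f z u v

/-- The submanifold `i : M₁ × M₂ → M` is semi-invariant of the form `M_T × M_⊥`: the first factor
(every leaf `M₁ × {y}`) is an invariant submanifold of `M`, and the second factor (every leaf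
`{x} × M₂`) is an anti-invariant submanifold of `M`. -/
def IsSemiInvariantProduct (J : ∀ x : M, TangentSpace I x →L[ℝ] TangentSpace I x)
    (i : M₁ × M₂ → M) : Prop :=
  (∀ y : M₂, IsInvariantSubmanifold I I₁ J (fun x : M₁ ↦ i (x, y))) ∧
    ∀ x : M₁, IsAntiInvariantSubmanifold I I₂ J (fun y : M₂ ↦ i (x, y))

end WarpedProduct

end

/-! Both sides of the identity are zero: the warping function has vanishing derivative in every
direction. The contradiction-free but rigid reason is that the parallel form `B(v, w) = g(Jv, w)`
obeys the same product rule as the metric.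

Fix a point, coordinate directions `a`, `c` on the first factor with `J∂_a = ∂_c` at that point, and
`b ≠ 0` on the second factor; let `D` be the covariant derivative along the immersion, so `D_r ∂_s =
D_s ∂_r`. Invariance of the leaves and orthogonality of the factors give `B(∂_a, ∂_b) = 0`, and
anti-invariance gives `B(∂_b, ∂_b) = 0`, on a whole neighbourhood. Differentiating the second along
`a` yields `B(D_b ∂_a, ∂_b) = 0`. Differentiating the first along `b` then leaves `B(∂_a, D_b ∂_b) =
0`, that is `g(∂_c, D_b ∂_b) = 0`. Since `g(∂_c, ∂_b) = 0`, this equals `-g(D_b ∂_c, ∂_b) = -∂_c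
g(∂_b, ∂_b) / 2`; as `g(∂_b, ∂_b)` is `f²` times a positive function on the fiber, `∂_c f = 0`. So
`f` is stationary along every `Ju` (`fderiv_warping_eq_zero` in coordinates,
`mvfderiv_warping_eq_zero` on the manifold).

Finally `J(Ju) = p Ju + q u` with `q ≠ 0` puts every `u` in the span of vectors of the form `Jv`, so
`df = 0`. -/

noncomputable section

/-! ### The computation in a vector space with Christoffel symbols -/

section Calculus

variable {V E : Type*} [NormedAddCommGroup V] [NormedSpace ℝ V]
  [NormedAddCommGroup E] [NormedSpace ℝ E]

/-- The covariant second derivative `D_r ∂_p F` at `z` of a map `F` into a space with Christoffel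
symbols `Γ`. -/
def secondCovDeriv (Γ : E → E → E) (F : V → E) (z r p : V) : E :=
  fderiv ℝ (fderiv ℝ F) z r p + Γ (fderiv ℝ F z r) (fderiv ℝ F z p)

/-- Second derivatives commute and the connection is torsion-free; this stands in for `∇_X Y = ∇_Y
X` for commuting fields. -/
theorem secondCovDeriv_comm {Γ : E → E → E} (hΓ : ∀ v w, Γ v w = Γ w v) {F : V → E} {z : V}
    (hF : ContDiffAt ℝ 2 F z) (r p : V) :
    secondCovDeriv Γ F z r p = secondCovDeriv Γ F z p r := by
  have h := hF.isSymmSndFDerivAt (by simp) r p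
  rw [secondCovDeriv, secondCovDeriv, h, hΓ]

/-- `B` is parallel at `y` for the connection with Christoffel symbols `Γ`. -/
def IsParallelFormAt (Γ : E → E → E) (B : E → E →L[ℝ] E →L[ℝ] ℝ) (y : E) : Prop :=
  DifferentiableAt ℝ B y ∧
    ∀ v w u, fderiv ℝ B y v w u = B y (Γ v w) u + B y w (Γ v u)

-- Product rule along `F`: the derivative of `B` contributes exactly the Christoffel terms that
-- complete the second derivatives of `F` to covariant ones. Only first derivatives of `B` enter, so
-- parallelism at the single point `F z` suffices.
set_option synthInstance.maxHeartbeats 200000 in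
theorem IsParallelFormAt.hasFDerivAt_apply {Γ : E → E → E} {B : E → E →L[ℝ] E →L[ℝ] ℝ}
    {F : V → E} {z : V} (hB : IsParallelFormAt Γ B (F z)) (hF : ContDiffAt ℝ 2 F z) (p q : V) :
    ∃ L : V →L[ℝ] ℝ,
      HasFDerivAt (fun w ↦ B (F w) (fderiv ℝ F w p) (fderiv ℝ F w q)) L z ∧
      ∀ r, L r = B (F z) (secondCovDeriv Γ F z r p) (fderiv ℝ F z q) +
        B (F z) (fderiv ℝ F z p) (secondCovDeriv Γ F z r q) := by
  have h1 : HasFDerivAt F (fderiv ℝ F z) z := (hF.differentiableAt (by norm_num)).hasFDerivAt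
  have h2 : HasFDerivAt (fderiv ℝ F) (fderiv ℝ (fderiv ℝ F) z) z :=
    ((hF.fderiv_right (m := 1) (by norm_num)).differentiableAt (by norm_num)).hasFDerivAt
  have h3 : HasFDerivAt (fun w ↦ B (F w)) ((fderiv ℝ B (F z)).comp (fderiv ℝ F z)) z :=
    HasFDerivAt.comp (G := E →L[ℝ] E →L[ℝ] ℝ) z hB.1.hasFDerivAt h1
  have hp := h2.clm_apply (hasFDerivAt_const p z)
  have hq := h2.clm_apply (hasFDerivAt_const q z)
  refine ⟨_, (h3.clm_apply hp).clm_apply hq, fun r ↦ ?_⟩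
  simp [secondCovDeriv, hB.2]
  ring

theorem IsParallelFormAt.eq_zero_of_eventually_eq_zero {Γ : E → E → E}
    {B : E → E →L[ℝ] E →L[ℝ] ℝ}
    {F : V → E} {z : V} (hB : IsParallelFormAt Γ B (F z)) (hF : ContDiffAt ℝ 2 F z) (p q : V)
    (h : ∀ᶠ w in nhds z, B (F w) (fderiv ℝ F w p) (fderiv ℝ F w q) = 0) (r : V) :
    B (F z) (secondCovDeriv Γ F z r p) (fderiv ℝ F z q) +
        B (F z) (fderiv ℝ F z p) (secondCovDeriv Γ F z r q) = 0 := by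
  obtain ⟨L, hL, hLr⟩ := hB.hasFDerivAt_apply hF p q
  rw [← hLr, hL.unique ((hasFDerivAt_const (0 : ℝ) z).congr_of_eventuallyEq h)]
  simp

/-- The warping function of a warped product `F`, parametrized by `E₁ × E₂`, has vanishing
derivative in the direction `c = J a`, where `B = G (J ·) ·` is parallel, the second factor is
anti-invariant and the first factor is invariant. -/
theorem fderiv_warping_eq_zero {E₁ E₂ : Type*} [NormedAddCommGroup E₁] [NormedSpace ℝ E₁]
    [NormedAddCommGroup E₂] [NormedSpace ℝ E₂]
    {Γ : E → E → E} (hΓ : ∀ v w, Γ v w = Γ w v) {F : E₁ × E₂ → E} {z : E₁ × E₂}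
    (hF : ContDiffAt ℝ 2 F z)
    {G B : E → E →L[ℝ] E →L[ℝ] ℝ} (hG : IsParallelFormAt Γ G (F z))
    (hB : IsParallelFormAt Γ B (F z))
    (hGs : ∀ v w, G (F z) v w = G (F z) w v) (hBs : ∀ v w, B (F z) v w = B (F z) w v)
    {a c : E₁} {b : E₂} {φ : E₁ → ℝ} {h : E₂ → ℝ} (hφ : DifferentiableAt ℝ φ z.1)
    (hφ0 : φ z.1 ≠ 0) (hh : h z.2 ≠ 0)
    (horth : ∀ᶠ w in nhds z, G (F w) (fderiv ℝ F w (c, 0)) (fderiv ℝ F w (0, b)) = 0)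
    (hwarp : ∀ᶠ w in nhds z,
      G (F w) (fderiv ℝ F w (0, b)) (fderiv ℝ F w (0, b)) = φ w.1 ^ 2 * h w.2)
    (hinv : ∀ᶠ w in nhds z, B (F w) (fderiv ℝ F w (a, 0)) (fderiv ℝ F w (0, b)) = 0)
    (hanti : ∀ᶠ w in nhds z, B (F w) (fderiv ℝ F w (0, b)) (fderiv ℝ F w (0, b)) = 0)
    (hJ : ∀ v, B (F z) (fderiv ℝ F z (a, 0)) v = G (F z) (fderiv ℝ F z (c, 0)) v) :
    fderiv ℝ φ z.1 c = 0 := by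
  -- With `D` for `secondCovDeriv`: `e1` is `G(D_b c, b) + G(c, D_b b) = 0`, `e3` becomes `B(D_b a,
  -- b) + G(c, D_b b) = 0`, `e4` becomes `2 B(D_b a, b) = 0`, and `e2` becomes `L (c, 0) = 2 G(D_b
  -- c, b)`. Together they force `L (c, 0) = 0`.
  have e1 := hG.eq_zero_of_eventually_eq_zero hF _ _ horth (0, b)
  have e3 := hB.eq_zero_of_eventually_eq_zero hF _ _ hinv (0, b)
  have e4 := hB.eq_zero_of_eventually_eq_zero hF _ _ hanti (a, 0)
  obtain ⟨L, hL, hLr⟩ := hG.hasFDerivAt_apply hF (0, b) (0, b)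
  have e2 := hLr (c, 0)
  rw [secondCovDeriv_comm hΓ hF (c, 0)] at e2
  rw [secondCovDeriv_comm hΓ hF (a, 0), hBs (fderiv ℝ F z (0, b))] at e4
  rw [hJ] at e3
  rw [hGs (fderiv ℝ F z (0, b))] at e2
  -- Along this line the second coordinate is fixed, so `h` is a constant factor and needs no
  -- differentiability.
  have hline : HasDerivAt (fun t : ℝ ↦ z + t • ((c, 0) : E₁ × E₂)) (c, 0) 0 := by
    simpa using ((hasDerivAt_id (0 : ℝ)).smul_const ((c, 0) : E₁ × E₂)).const_add z
  have hL' : HasFDerivAt (fun w : E₁ × E₂ ↦ φ w.1 ^ 2 * h w.2) L z :=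
    hL.congr_of_eventuallyEq (hwarp.mono fun w hw ↦ hw.symm)
  have hd1 : HasDerivAt (fun t : ℝ ↦ φ (z.1 + t • c) ^ 2 * h z.2) (L (c, 0)) 0 := by
    have := HasFDerivAt.comp_hasDerivAt_of_eq (0 : ℝ) hL' hline (by simp)
    refine this.congr_of_eventuallyEq (Filter.Eventually.of_forall fun t ↦ ?_)
    simp
  have hline1 : HasDerivAt (fun t : ℝ ↦ z.1 + t • c) c 0 := by
    simpa using ((hasDerivAt_id (0 : ℝ)).smul_const c).const_add z.1
  have hd2 := ((HasFDerivAt.comp_hasDerivAt_of_eq (0 : ℝ) hφ.hasFDerivAt hline1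
    (by simp)).pow 2).mul_const (h z.2)
  have e5 := hd1.unique hd2
  simp at e5
  have e6 : φ z.1 * fderiv ℝ φ z.1 c * h z.2 = 0 := by linarith
  simpa [hφ0, hh] using e6

end Calculus

/-! ### Coordinate vector fields and forms in a chart -/

section Coordinates

variable {E : Type*} [NormedAddCommGroup E] [NormedSpace ℝ E]
  {M : Type*} [TopologicalSpace M] [ChartedSpace E M]

/-- The vector field on a vector space with constant value `w`. -/
def constField (w : E) : ∀ x : E, TangentSpace 𝓘(ℝ, E) x :=
  fun _ ↦ w

/-- The coordinate vector field with constant coordinates `w` in the chart at `m`. -/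
def coordField (m : M) (w : E) : ∀ x : M, TangentSpace 𝓘(ℝ, E) x :=
  VectorField.mpullback 𝓘(ℝ, E) 𝓘(ℝ, E) (extChartAt 𝓘(ℝ, E) m) (constField w)

/-- The differential of the inverse of the chart at `m`, at the point with coordinates `y`. -/
def chartSymmDeriv (m : M) (y : E) :
    E →L[ℝ] TangentSpace 𝓘(ℝ, E) ((extChartAt 𝓘(ℝ, E) m).symm y) :=
  mfderiv 𝓘(ℝ, E) 𝓘(ℝ, E) (extChartAt 𝓘(ℝ, E) m).symm y

/-- The differential of the chart at `m`. -/
def chartDeriv (m x : M) : TangentSpace 𝓘(ℝ, E) x →L[ℝ] E :=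
  mfderiv 𝓘(ℝ, E) 𝓘(ℝ, E) (extChartAt 𝓘(ℝ, E) m) x

/-- The expression of a bilinear form on the tangent bundle in the chart at `m`. -/
def coordForm (b : ∀ x : M, TangentSpace 𝓘(ℝ, E) x →L[ℝ] TangentSpace 𝓘(ℝ, E) x →L[ℝ] ℝ)
    (m : M) (y : E) : E →L[ℝ] E →L[ℝ] ℝ :=
  (ContinuousLinearMap.precomp ℝ (chartSymmDeriv m y)).comp ((b _).comp (chartSymmDeriv m y))

theorem coordForm_apply
    (b : ∀ x : M, TangentSpace 𝓘(ℝ, E) x →L[ℝ] TangentSpace 𝓘(ℝ, E) x →L[ℝ] ℝ)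
    (m : M) (y v w : E) : coordForm b m y v w =
      b _ (chartSymmDeriv m y v) (chartSymmDeriv m y w) := rfl

variable [IsManifold 𝓘(ℝ, E) ∞ M]

theorem contMDiffAt_extChartAt_symm {m : M} {y : E} (hy : y ∈ (extChartAt 𝓘(ℝ, E) m).target) :
    ContMDiffAt 𝓘(ℝ, E) 𝓘(ℝ, E) ∞ (extChartAt 𝓘(ℝ, E) m).symm y :=
  (contMDiffOn_extChartAt_symm m).contMDiffAt ((isOpen_extChartAt_target m).mem_nhds hy)

theorem chartSymmDeriv_chartDeriv {m : M} {y : E} (hy : y ∈ (extChartAt 𝓘(ℝ, E) m).target)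
    (u : TangentSpace 𝓘(ℝ, E) ((extChartAt 𝓘(ℝ, E) m).symm y)) :
    chartSymmDeriv m y (chartDeriv m _ u) = u := by
  have : IsManifold 𝓘(ℝ, E) 1 M := IsManifold.of_le (n := ∞) (by norm_cast)
  have h := mfderivWithin_extChartAt_symm_comp_mfderiv_extChartAt (I := 𝓘(ℝ, E)) hy
  rw [modelWithCornersSelf_coe, Set.range_id, mfderivWithin_univ] at h
  exact congr($h u)

theorem chartDeriv_chartSymmDeriv {m : M} {y : E} (hy : y ∈ (extChartAt 𝓘(ℝ, E) m).target)
    (w : E) : chartDeriv m _ (chartSymmDeriv m y w) = w := by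
  have : IsManifold 𝓘(ℝ, E) 1 M := IsManifold.of_le (n := ∞) (by norm_cast)
  have h := mfderiv_extChartAt_comp_mfderivWithin_extChartAt_symm (I := 𝓘(ℝ, E)) hy
  rw [modelWithCornersSelf_coe, Set.range_id, mfderivWithin_univ] at h
  exact congr($h w)

theorem coordField_extChartAt_symm {m : M} {y : E} (hy : y ∈ (extChartAt 𝓘(ℝ, E) m).target)
    (w : E) : coordField m w ((extChartAt 𝓘(ℝ, E) m).symm y) = chartSymmDeriv m y w := by
  have h : (chartDeriv m ((extChartAt 𝓘(ℝ, E) m).symm y)).inverse = chartSymmDeriv m y :=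
    ContinuousLinearMap.inverse_eq
      (ContinuousLinearMap.ext fun v ↦ chartDeriv_chartSymmDeriv hy v)
      (ContinuousLinearMap.ext fun v ↦ chartSymmDeriv_chartDeriv hy v)
  exact congr($h w)

theorem coordForm_eq_coordField
    (b : ∀ x : M, TangentSpace 𝓘(ℝ, E) x →L[ℝ] TangentSpace 𝓘(ℝ, E) x →L[ℝ] ℝ)
    {m : M} {y : E} (hy : y ∈ (extChartAt 𝓘(ℝ, E) m).target) (v w : E) :
    coordForm b m y v w =
      b ((extChartAt 𝓘(ℝ, E) m).symm y) (coordField m v _) (coordField m w _) := by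
  rw [coordField_extChartAt_symm hy, coordField_extChartAt_symm hy, coordForm_apply]

theorem contMDiffAt_constField (w x : E) :
    ContMDiffAt 𝓘(ℝ, E) (𝓘(ℝ, E).prod 𝓘(ℝ, E)) 1
      (fun x ↦ TotalSpace.mk' E (E := fun x : E ↦ TangentSpace 𝓘(ℝ, E) x) x (constField w x))
      x :=
  contMDiffAt_vectorSpace_iff_contDiffAt.2 contDiffAt_const

variable [CompleteSpace E]

theorem contMDiffAt_coordField {m x : M} (hx : x ∈ (extChartAt 𝓘(ℝ, E) m).source) (w : E) :
    ContMDiffAt 𝓘(ℝ, E) (𝓘(ℝ, E).prod 𝓘(ℝ, E)) 1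
      (fun x ↦ TotalSpace.mk' E (E := fun x : M ↦ TangentSpace 𝓘(ℝ, E) x) x (coordField m w x))
      x := by
  have : IsManifold 𝓘(ℝ, E) 1 M := IsManifold.of_le (n := ∞) (by norm_cast)
  have : IsManifold 𝓘(ℝ, E) 2 M := IsManifold.of_le (n := ∞) (by norm_cast)
  have : IsManifold 𝓘(ℝ, E) (1 + 1) M := by rwa [one_add_one_eq_two]
  refine ContMDiffAt.mpullback_vectorField_preimage (n := ∞) (contMDiffAt_constField w _)
    (contMDiffAt_extChartAt' (by simpa using hx)) (isInvertible_mfderiv_extChartAt hx) ?_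
  norm_cast

/-- Lie brackets are natural under pullback by the chart, and constant fields on a vector space
commute. -/
theorem mlieBracket_coordField (m : M) (v w : E) :
    VectorField.mlieBracket 𝓘(ℝ, E) (coordField m v) (coordField m w) m = 0 := by
  have : IsManifold 𝓘(ℝ, E) 2 M := IsManifold.of_le (n := ∞) (by norm_cast)
  have : IsManifold 𝓘(ℝ, E) (minSmoothness ℝ 2) M := by simpa
  have hc (w : E) := (contMDiffAt_constField w (extChartAt 𝓘(ℝ, E) m m)).mdifferentiableAt
    one_ne_zero
  refine (VectorField.mpullback_mlieBracket (hc v) (hc w) (contMDiffAt_extChartAt (n := ∞))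
    (by simp; norm_cast)).symm.trans ?_
  have h0 : VectorField.mlieBracket 𝓘(ℝ, E) (constField v) (constField w) = 0 := by
    rw [← VectorField.mlieBracketWithin_univ, VectorField.mlieBracketWithin_eq_lieBracketWithin]
    have hz (u x : E) : fderivWithin ℝ (constField u : E → E) Set.univ x = 0 :=
      (hasFDerivAt_const u x).hasFDerivWithinAt.fderivWithin uniqueDiffWithinAt_univ
    ext x
    simp only [VectorField.lieBracketWithin, hz]
    exact sub_zero (0 : E)
  rw [h0, VectorField.mpullback_zero, Pi.zero_apply]

end Coordinates

/-! ### Parallel bilinear forms in coordinates -/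

section ParallelForms

variable {E : Type*} [NormedAddCommGroup E] [NormedSpace ℝ E]
  {M : Type*} [TopologicalSpace M] [ChartedSpace E M] [IsManifold 𝓘(ℝ, E) ∞ M]

/-- The Christoffel symbols at `m` of the connection `nabla` in the chart at `m`. -/
def christoffel (nabla : CovariantDerivative 𝓘(ℝ, E) E (fun x : M ↦ TangentSpace 𝓘(ℝ, E) x))
    (m : M) (v w : E) : E :=
  chartDeriv m m (nabla (coordField m w) m (coordField m v m))

/-- The bilinear form `b` on the tangent bundle is parallel at `m`. -/
def IsParallelBilinAt
    (nabla : CovariantDerivative 𝓘(ℝ, E) E (fun x : M ↦ TangentSpace 𝓘(ℝ, E) x))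
    (b : ∀ x : M, TangentSpace 𝓘(ℝ, E) x →L[ℝ] TangentSpace 𝓘(ℝ, E) x →L[ℝ] ℝ) (m : M) : Prop :=
  ∀ σ τ : ∀ x : M, TangentSpace 𝓘(ℝ, E) x,
    MDifferentiableAt 𝓘(ℝ, E) (𝓘(ℝ, E).prod 𝓘(ℝ, E)) (fun y ↦ TotalSpace.mk' E y (σ y)) m →
    MDifferentiableAt 𝓘(ℝ, E) (𝓘(ℝ, E).prod 𝓘(ℝ, E)) (fun y ↦ TotalSpace.mk' E y (τ y)) m →
    ∀ u : TangentSpace 𝓘(ℝ, E) m, mvfderiv 𝓘(ℝ, E) (fun x ↦ b x (σ x) (τ x)) m u =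
      b m (nabla σ m u) (τ m) + b m (σ m) (nabla τ m u)

theorem coordField_chartDeriv {m x : M} (hx : x ∈ (extChartAt 𝓘(ℝ, E) m).source)
    (u : TangentSpace 𝓘(ℝ, E) x) : coordField m (chartDeriv m x u) x = u := by
  have hy := (extChartAt 𝓘(ℝ, E) m).map_source hx
  -- The type of `u` depends on the base point, so `u` is generalized before `left_inv` rewrites
  -- that point.
  have h : ∀ u : TangentSpace 𝓘(ℝ, E)
      ((extChartAt 𝓘(ℝ, E) m).symm (extChartAt 𝓘(ℝ, E) m x)),
      coordField m (chartDeriv m _ u) _ = u := fun u ↦ by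
    rw [coordField_extChartAt_symm hy, chartSymmDeriv_chartDeriv hy]
  rw [(extChartAt 𝓘(ℝ, E) m).left_inv hx] at h
  exact h u

theorem coordForm_extChartAt_self
    (b : ∀ x : M, TangentSpace 𝓘(ℝ, E) x →L[ℝ] TangentSpace 𝓘(ℝ, E) x →L[ℝ] ℝ)
    (m : M) (v w : E) : coordForm b m (extChartAt 𝓘(ℝ, E) m m) v w =
      b m (coordField m v m) (coordField m w m) := by
  rw [coordForm_eq_coordField b (mem_extChartAt_target m), extChartAt_to_inv]

variable [FiniteDimensional ℝ E]

/-- Testing parallelism at `m` on coordinate fields gives the coordinate identity, since the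
Christoffel symbols are the components of the covariant derivatives of those fields. -/
theorem isParallelFormAt_coordForm
    {nabla : CovariantDerivative 𝓘(ℝ, E) E (fun x : M ↦ TangentSpace 𝓘(ℝ, E) x)}
    {b : ∀ x : M, TangentSpace 𝓘(ℝ, E) x →L[ℝ] TangentSpace 𝓘(ℝ, E) x →L[ℝ] ℝ} {m : M}
    (hb : ∀ x ∈ (extChartAt 𝓘(ℝ, E) m).source, ∀ v w : E, ContMDiffAt 𝓘(ℝ, E) 𝓘(ℝ, ℝ) 1
      (fun x ↦ b x (coordField m v x) (coordField m w x)) x)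
    (hpar : IsParallelBilinAt nabla b m) :
    IsParallelFormAt (christoffel nabla m) (coordForm b m) (extChartAt 𝓘(ℝ, E) m m) := by
  have := FiniteDimensional.complete ℝ E
  set e := extChartAt 𝓘(ℝ, E) m with he
  have hopen : IsOpen e.target := isOpen_extChartAt_target m
  have hme : e m ∈ e.target := mem_extChartAt_target m
  have hcoord (v w : E) {y : E} (hy : y ∈ e.target) :
      (fun y ↦ coordForm b m y v w) =ᶠ[nhds y]
        (fun x ↦ b x (coordField m v x) (coordField m w x)) ∘ e.symm := by
    filter_upwards [hopen.mem_nhds hy] with y' hy'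
    exact coordForm_eq_coordField b hy' v w
  -- In finite dimension a form-valued map is `C¹` as soon as all its components are.
  have hdiff : ContDiffOn ℝ 1 (coordForm b m) e.target := by
    refine contDiffOn_clm_apply.2 fun v ↦ contDiffOn_clm_apply.2 fun w y hy ↦ ?_
    have h1 : ContMDiffAt 𝓘(ℝ, E) 𝓘(ℝ, ℝ) 1
        ((fun x ↦ b x (coordField m v x) (coordField m w x)) ∘ e.symm) y :=
      (hb _ (e.map_target hy) v w).comp y
        ((contMDiffAt_extChartAt_symm hy).of_le (by norm_cast))
    exact (h1.contDiffAt.congr_of_eventuallyEq (hcoord v w hy)).contDiffWithinAt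
  have hd : DifferentiableAt ℝ (coordForm b m) (e m) :=
    (hdiff.contDiffAt (hopen.mem_nhds hme)).differentiableAt one_ne_zero
  refine ⟨hd, fun v w u ↦ ?_⟩
  have h1 : fderiv ℝ (coordForm b m) (e m) v w u =
      fderiv ℝ (fun y ↦ coordForm b m y w u) (e m) v := by
    have := (hd.hasFDerivAt.clm_apply (hasFDerivAt_const w (e m))).clm_apply
      (hasFDerivAt_const u (e m))
    rw [this.fderiv]
    simp
  have h2 : ∀ {y : E}, y ∈ e.target → fderiv ℝ (fun y ↦ coordForm b m y w u) y v =
      mvfderiv 𝓘(ℝ, E) (fun x ↦ b x (coordField m w x) (coordField m u x)) (e.symm y)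
        (coordField m v (e.symm y)) := fun {y} hy ↦ by
    rw [(hcoord w u hy).fderiv_eq, coordField_extChartAt_symm hy, ← mfderiv_eq_fderiv]
    exact mfderiv_comp_apply y
      ((hb _ (e.map_target hy) w u).mdifferentiableAt one_ne_zero)
      ((contMDiffAt_extChartAt_symm hy).mdifferentiableAt (by simp)) v
  have hm := mem_extChartAt_source (I := 𝓘(ℝ, E)) m
  have hsm (w : E) := (contMDiffAt_coordField hm w).mdifferentiableAt one_ne_zero
  have h3 := h2 hme
  rw [he, extChartAt_to_inv] at h3
  rw [h1, h3, hpar _ _ (hsm w) (hsm u), he, coordForm_extChartAt_self, coordForm_extChartAt_self,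
    christoffel, christoffel, coordField_chartDeriv hm, coordField_chartDeriv hm]

end ParallelForms

/-! ### The metric and `g (J ·) ·` are parallel -/

section Riemannian

variable {E : Type*} [NormedAddCommGroup E] [NormedSpace ℝ E]
  {M : Type*} [TopologicalSpace M] [ChartedSpace E M]
  [RiemannianBundle (fun x : M ↦ TangentSpace 𝓘(ℝ, E) x)]

/-- The metric as a bilinear form. -/
def metricForm (x : M) : TangentSpace 𝓘(ℝ, E) x →L[ℝ] TangentSpace 𝓘(ℝ, E) x →L[ℝ] ℝ :=
  innerSL ℝ

/-- The bilinear form `g (J ·) ·`. -/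
def tensorForm (J : ∀ x : M, TangentSpace 𝓘(ℝ, E) x →L[ℝ] TangentSpace 𝓘(ℝ, E) x) (x : M) :
    TangentSpace 𝓘(ℝ, E) x →L[ℝ] TangentSpace 𝓘(ℝ, E) x →L[ℝ] ℝ :=
  (metricForm x).comp (J x)

theorem metricForm_apply (x : M) (v w : TangentSpace 𝓘(ℝ, E) x) :
    metricForm x v w = inner ℝ v w := rfl

theorem tensorForm_apply
    (J : ∀ x : M, TangentSpace 𝓘(ℝ, E) x →L[ℝ] TangentSpace 𝓘(ℝ, E) x) (x : M)
    (v w : TangentSpace 𝓘(ℝ, E) x) : tensorForm J x v w = inner ℝ (J x v) w := rfl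

variable [FiniteDimensional ℝ E] [IsManifold 𝓘(ℝ, E) ∞ M]
  [IsContMDiffRiemannianBundle 𝓘(ℝ, E) ∞ E (fun x : M ↦ TangentSpace 𝓘(ℝ, E) x)]

theorem christoffel_comm
    {nabla : CovariantDerivative 𝓘(ℝ, E) E (fun x : M ↦ TangentSpace 𝓘(ℝ, E) x)}
    (h : IsLeviCivita nabla) (m : M) (v w : E) :
    christoffel nabla m v w = christoffel nabla m w v := by
  have := FiniteDimensional.complete ℝ E
  have hm := mem_extChartAt_source (I := 𝓘(ℝ, E)) m
  have hsm (w : E) := (contMDiffAt_coordField hm w).mdifferentiableAt one_ne_zero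
  have h2 := nabla.torsion_eq_zero_iff.1 h.2 (hsm v) (hsm w)
  rw [mlieBracket_coordField, sub_eq_zero] at h2
  rw [christoffel, christoffel, h2]

theorem isParallelFormAt_metric
    {nabla : CovariantDerivative 𝓘(ℝ, E) E (fun x : M ↦ TangentSpace 𝓘(ℝ, E) x)}
    (h : IsLeviCivita nabla) (m : M) :
    IsParallelFormAt (christoffel nabla m) (coordForm metricForm m)
      (extChartAt 𝓘(ℝ, E) m m) := by
  have := FiniteDimensional.complete ℝ E
  refine isParallelFormAt_coordForm (fun x hx v w ↦ ?_) fun σ τ hσ hτ u ↦ ?_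
  · exact ContMDiffAt.inner_bundle (E := fun x : M ↦ TangentSpace 𝓘(ℝ, E) x) (b := fun x ↦ x)
      (contMDiffAt_coordField hx v) (contMDiffAt_coordField hx w)
  -- Metric compatibility is phrased with a vector field as direction, so the vector `u` is extended
  -- to a field.
  · have := h.1.mvfderiv_inner_eq (FiberBundle.extend E u) hσ hτ
    simpa [metricForm_apply] using this

/-- Metric compatibility is applied to the fields `Jσ` and `τ`, and `∇J = 0` replaces `∇(Jσ)` by
`J(∇σ)`. -/
theorem isParallelFormAt_tensor
    {nabla : CovariantDerivative 𝓘(ℝ, E) E (fun x : M ↦ TangentSpace 𝓘(ℝ, E) x)}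
    (h : IsLeviCivita nabla)
    {J : ∀ x : M, TangentSpace 𝓘(ℝ, E) x →L[ℝ] TangentSpace 𝓘(ℝ, E) x}
    (hJ : ContMDiff 𝓘(ℝ, E) (𝓘(ℝ, E).prod 𝓘(ℝ, E →L[ℝ] E)) ∞
      (fun x ↦ TotalSpace.mk' (E →L[ℝ] E)
        (E := fun x : M ↦ TangentSpace 𝓘(ℝ, E) x →L[ℝ] TangentSpace 𝓘(ℝ, E) x) x (J x)))
    (hpar : IsParallelTensor nabla J) (m : M) :
    IsParallelFormAt (christoffel nabla m) (coordForm (tensorForm J) m)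
      (extChartAt 𝓘(ℝ, E) m m) := by
  have := FiniteDimensional.complete ℝ E
  refine isParallelFormAt_coordForm (fun x hx v w ↦ ?_) fun σ τ hσ hτ u ↦ ?_
  · exact ContMDiffAt.inner_bundle (E := fun x : M ↦ TangentSpace 𝓘(ℝ, E) x) (b := fun x ↦ x)
      ((hJ.contMDiffAt.of_le (by norm_cast)).clm_bundle_apply (contMDiffAt_coordField hx v))
      (contMDiffAt_coordField hx w)
  · have hJσ := ((hJ.contMDiffAt (x := m)).mdifferentiableAt (by simp)).clm_bundle_apply hσ
    have := h.1.mvfderiv_inner_eq (FiberBundle.extend E u) hJσ hτ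
    have h3 := sub_eq_zero.1 (hpar m σ hσ u)
    simp only [FiberBundle.extend_apply_self] at this
    rw [h3] at this
    exact this

end Riemannian

/-! ### Immersed warped products and their coordinate expression -/

section WarpedProducts

variable {E : Type*} [NormedAddCommGroup E] [NormedSpace ℝ E]
  {M : Type*} [TopologicalSpace M] [ChartedSpace E M]
  {E₁ : Type*} [NormedAddCommGroup E₁] [NormedSpace ℝ E₁]
  {M₁ : Type*} [TopologicalSpace M₁] [ChartedSpace E₁ M₁]
  {E₂ : Type*} [NormedAddCommGroup E₂] [NormedSpace ℝ E₂]
  {M₂ : Type*} [TopologicalSpace M₂] [ChartedSpace E₂ M₂]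
  {i : M₁ × M₂ → M}

variable (E E₁ E₂) in
/-- The differential of a map on a product manifold, applied to a pair of tangent vectors. -/
def prodDeriv (i : M₁ × M₂ → M) (z : M₁ × M₂) (u : TangentSpace 𝓘(ℝ, E₁) z.1)
    (v : TangentSpace 𝓘(ℝ, E₂) z.2) : TangentSpace 𝓘(ℝ, E) (i z) :=
  mfderiv (𝓘(ℝ, E₁).prod 𝓘(ℝ, E₂)) 𝓘(ℝ, E) i z (show E₁ × E₂ from (u, v))

/-- Chain rule through the inclusion of a leaf; it turns conditions on the leaves into conditions on
the differential of `i`. -/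
theorem mfderiv_leaf_left (hi : MDifferentiable (𝓘(ℝ, E₁).prod 𝓘(ℝ, E₂)) 𝓘(ℝ, E) i)
    (z : M₁ × M₂) (u : TangentSpace 𝓘(ℝ, E₁) z.1) :
    mfderiv 𝓘(ℝ, E₁) 𝓘(ℝ, E) (fun x : M₁ ↦ i (x, z.2)) z.1 u = prodDeriv E E₁ E₂ i z u 0 := by
  have h := mfderiv_comp_apply (I := 𝓘(ℝ, E₁)) (I' := 𝓘(ℝ, E₁).prod 𝓘(ℝ, E₂)) (I'' := 𝓘(ℝ, E))
    z.1 (g := i) (f := fun x ↦ (x, z.2)) (hi _)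
    (mdifferentiableAt_id.prodMk mdifferentiableAt_const) u
  rw [mfderiv_prod_left] at h
  exact h

theorem mfderiv_leaf_right (hi : MDifferentiable (𝓘(ℝ, E₁).prod 𝓘(ℝ, E₂)) 𝓘(ℝ, E) i)
    (z : M₁ × M₂) (v : TangentSpace 𝓘(ℝ, E₂) z.2) :
    mfderiv 𝓘(ℝ, E₂) 𝓘(ℝ, E) (fun y : M₂ ↦ i (z.1, y)) z.2 v = prodDeriv E E₁ E₂ i z 0 v := by
  have h := mfderiv_comp_apply (I := 𝓘(ℝ, E₂)) (I' := 𝓘(ℝ, E₁).prod 𝓘(ℝ, E₂)) (I'' := 𝓘(ℝ, E))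
    z.2 (g := i) (f := fun y ↦ (z.1, y)) (hi _)
    (mdifferentiableAt_const.prodMk mdifferentiableAt_id) v
  rw [mfderiv_prod_right] at h
  exact h

section Metric

variable [RiemannianBundle (fun x : M ↦ TangentSpace 𝓘(ℝ, E) x)]
  {f : M₁ → ℝ} {J : ∀ x : M, TangentSpace 𝓘(ℝ, E) x →L[ℝ] TangentSpace 𝓘(ℝ, E) x}

theorem IsSemiInvariantProduct.exists_prodDeriv_left
    (h : IsSemiInvariantProduct 𝓘(ℝ, E) 𝓘(ℝ, E₁) 𝓘(ℝ, E₂) J i)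
    (hi : MDifferentiable (𝓘(ℝ, E₁).prod 𝓘(ℝ, E₂)) 𝓘(ℝ, E) i)
    (z : M₁ × M₂) (u : TangentSpace 𝓘(ℝ, E₁) z.1) :
    ∃ u' : TangentSpace 𝓘(ℝ, E₁) z.1,
      J (i z) (prodDeriv E E₁ E₂ i z u 0) = prodDeriv E E₁ E₂ i z u' 0 := by
  obtain ⟨u', hu'⟩ := h.1 z.2 z.1 _ ⟨u, rfl⟩
  refine ⟨u', ?_⟩
  rw [← mfderiv_leaf_left hi, ← mfderiv_leaf_left hi]
  exact hu'.symm

theorem IsSemiInvariantProduct.inner_prodDeriv_right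
    (h : IsSemiInvariantProduct 𝓘(ℝ, E) 𝓘(ℝ, E₁) 𝓘(ℝ, E₂) J i)
    (hi : MDifferentiable (𝓘(ℝ, E₁).prod 𝓘(ℝ, E₂)) 𝓘(ℝ, E) i)
    (z : M₁ × M₂) (v w : TangentSpace 𝓘(ℝ, E₂) z.2) :
    inner ℝ (J (i z) (prodDeriv E E₁ E₂ i z 0 v)) (prodDeriv E E₁ E₂ i z 0 w) = 0 := by
  have h1 := (Submodule.mem_orthogonal' _ _).1 (h.2 z.1 z.2 _ ⟨v, rfl⟩) _ ⟨w, rfl⟩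
  rw [← mfderiv_leaf_right hi, ← mfderiv_leaf_right hi]
  exact h1

variable [RiemannianBundle (fun x : M₁ ↦ TangentSpace 𝓘(ℝ, E₁) x)]
  [RiemannianBundle (fun x : M₂ ↦ TangentSpace 𝓘(ℝ, E₂) x)]

theorem IsWarpedProductIsometric.inner_prodDeriv
    (h : IsWarpedProductIsometric 𝓘(ℝ, E) 𝓘(ℝ, E₁) 𝓘(ℝ, E₂) f i) (z : M₁ × M₂)
    (u u' : TangentSpace 𝓘(ℝ, E₁) z.1) (v v' : TangentSpace 𝓘(ℝ, E₂) z.2) :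
    inner ℝ (prodDeriv E E₁ E₂ i z u v) (prodDeriv E E₁ E₂ i z u' v') =
      inner ℝ u u' + f z.1 ^ 2 * inner ℝ v v' := by
  have h1 (U V : TangentSpace (𝓘(ℝ, E₁).prod 𝓘(ℝ, E₂)) z) := h z U V
  simp only [warpedMetric, mfderiv_fst, mfderiv_snd] at h1
  exact h1 (show E₁ × E₂ from (u, v)) (show E₁ × E₂ from (u', v'))

end Metric

section Chart

/-- The parametrization of `M₁ × M₂` near `z` by the charts of the factors. -/
def prodParam (z : M₁ × M₂) (w : E₁ × E₂) : M₁ × M₂ :=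
  ((extChartAt 𝓘(ℝ, E₁) z.1).symm w.1, (extChartAt 𝓘(ℝ, E₂) z.2).symm w.2)

/-- The differential of the parametrization of the first factor. -/
def paramDerivLeft (z : M₁ × M₂) (w : E₁ × E₂) :
    E₁ →L[ℝ] TangentSpace 𝓘(ℝ, E₁) (prodParam z w).1 :=
  chartSymmDeriv z.1 w.1

/-- The differential of the parametrization of the second factor. -/
def paramDerivRight (z : M₁ × M₂) (w : E₁ × E₂) :
    E₂ →L[ℝ] TangentSpace 𝓘(ℝ, E₂) (prodParam z w).2 :=
  chartSymmDeriv z.2 w.2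

variable (E E₁ E₂) in
/-- The map `i` in the charts at `z` and `i z`. -/
def prodCoordMap (i : M₁ × M₂ → M) (z : M₁ × M₂) (w : E₁ × E₂) : E :=
  extChartAt 𝓘(ℝ, E) (i z) (i (prodParam z w))

variable (E₁ E₂) in
/-- The coordinates of `z`. -/
def prodCoord (z : M₁ × M₂) : E₁ × E₂ :=
  (extChartAt 𝓘(ℝ, E₁) z.1 z.1, extChartAt 𝓘(ℝ, E₂) z.2 z.2)

theorem prodParam_prodCoord (z : M₁ × M₂) :
    prodParam z (prodCoord E₁ E₂ z) = z := by
  simp [prodParam, prodCoord]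

variable [IsManifold 𝓘(ℝ, E₁) ∞ M₁] [IsManifold 𝓘(ℝ, E₂) ∞ M₂]

theorem contMDiffAt_prodParam {z : M₁ × M₂} {w : E₁ × E₂}
    (h1 : w.1 ∈ (extChartAt 𝓘(ℝ, E₁) z.1).target) (h2 : w.2 ∈ (extChartAt 𝓘(ℝ, E₂) z.2).target) :
    ContMDiffAt 𝓘(ℝ, E₁ × E₂) (𝓘(ℝ, E₁).prod 𝓘(ℝ, E₂)) ∞ (prodParam z) w :=
  ((contMDiffAt_extChartAt_symm h1).comp w contDiff_fst.contMDiff.contMDiffAt).prodMk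
    ((contMDiffAt_extChartAt_symm h2).comp w contDiff_snd.contMDiff.contMDiffAt)

theorem hasMFDerivAt_prodParam {z : M₁ × M₂} {w : E₁ × E₂}
    (h1 : w.1 ∈ (extChartAt 𝓘(ℝ, E₁) z.1).target) (h2 : w.2 ∈ (extChartAt 𝓘(ℝ, E₂) z.2).target) :
    HasMFDerivAt 𝓘(ℝ, E₁ × E₂) (𝓘(ℝ, E₁).prod 𝓘(ℝ, E₂)) (prodParam z) w
      (((chartSymmDeriv z.1 w.1).comp (ContinuousLinearMap.fst ℝ E₁ E₂)).prod
        ((chartSymmDeriv z.2 w.2).comp (ContinuousLinearMap.snd ℝ E₁ E₂))) :=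
  (((contMDiffAt_extChartAt_symm h1).mdifferentiableAt (by simp)).hasMFDerivAt.comp w
      hasFDerivAt_fst.hasMFDerivAt).prodMk
    (((contMDiffAt_extChartAt_symm h2).mdifferentiableAt (by simp)).hasMFDerivAt.comp w
      hasFDerivAt_snd.hasMFDerivAt)

variable (E E₁ E₂) in
theorem eventually_mem_chart (hi : Continuous i) (z : M₁ × M₂) :
    ∀ᶠ w in nhds (prodCoord E₁ E₂ z), w.1 ∈ (extChartAt 𝓘(ℝ, E₁) z.1).target ∧
      w.2 ∈ (extChartAt 𝓘(ℝ, E₂) z.2).target ∧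
      i (prodParam z w) ∈ (extChartAt 𝓘(ℝ, E) (i z)).source := by
  have h1 := (isOpen_extChartAt_target (I := 𝓘(ℝ, E₁)) z.1).mem_nhds (mem_extChartAt_target z.1)
  have h2 := (isOpen_extChartAt_target (I := 𝓘(ℝ, E₂)) z.2).mem_nhds (mem_extChartAt_target z.2)
  have h3 : ContinuousAt (fun w ↦ i (prodParam z w)) (prodCoord E₁ E₂ z) :=
    hi.continuousAt.comp (contMDiffAt_prodParam (mem_extChartAt_target z.1)
      (mem_extChartAt_target z.2)).continuousAt
  have h4 : (extChartAt 𝓘(ℝ, E) (i z)).source ∈ nhds (i (prodParam z (prodCoord E₁ E₂ z))) := by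
    rw [prodParam_prodCoord]
    exact extChartAt_source_mem_nhds _
  filter_upwards [continuous_fst.continuousAt.preimage_mem_nhds h1,
    continuous_snd.continuousAt.preimage_mem_nhds h2, h3.preimage_mem_nhds h4] with w a b c
  exact ⟨a, b, c⟩

variable [IsManifold 𝓘(ℝ, E) ∞ M]

theorem contDiffAt_prodCoordMap (hi : ContMDiff (𝓘(ℝ, E₁).prod 𝓘(ℝ, E₂)) 𝓘(ℝ, E) ∞ i)
    (z : M₁ × M₂) : ContDiffAt ℝ ∞ (prodCoordMap E E₁ E₂ i z)
      (prodCoord E₁ E₂ z) := by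
  obtain ⟨h1, h2, h3⟩ := (eventually_mem_chart E E₁ E₂ hi.continuous z).self_of_nhds
  exact ((contMDiffAt_extChartAt' (by simpa using h3)).comp _
    (hi.contMDiffAt.comp _ (contMDiffAt_prodParam h1 h2))).contDiffAt

theorem fderiv_prodCoordMap (hi : MDifferentiable (𝓘(ℝ, E₁).prod 𝓘(ℝ, E₂)) 𝓘(ℝ, E) i)
    {z : M₁ × M₂} {w : E₁ × E₂}
    (h1 : w.1 ∈ (extChartAt 𝓘(ℝ, E₁) z.1).target) (h2 : w.2 ∈ (extChartAt 𝓘(ℝ, E₂) z.2).target)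
    (h3 : i (prodParam z w) ∈ (extChartAt 𝓘(ℝ, E) (i z)).source) (p : E₁ × E₂) :
    fderiv ℝ (prodCoordMap E E₁ E₂ i z) w p = chartDeriv (i z) (i (prodParam z w))
      (prodDeriv E E₁ E₂ i (prodParam z w) (paramDerivLeft z w p.1) (paramDerivRight z w p.2)) := by
  have : IsManifold 𝓘(ℝ, E) 1 M := IsManifold.of_le (n := ∞) (by norm_cast)
  have h := ((mdifferentiableAt_extChartAt (I := 𝓘(ℝ, E)) (by simpa using h3)).hasMFDerivAt.comp w
    ((hi (prodParam z w)).hasMFDerivAt.comp w (hasMFDerivAt_prodParam h1 h2)))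
  -- The derivative is hidden behind `L`, keeping only its values, which agree definitionally with
  -- the chart and product differentials.
  obtain ⟨L, hL, hLp⟩ : ∃ L : E₁ × E₂ →L[ℝ] E, HasFDerivAt (prodCoordMap E E₁ E₂ i z) L w ∧
      ∀ p, L p = chartDeriv (i z) (i (prodParam z w))
        (prodDeriv E E₁ E₂ i (prodParam z w) (paramDerivLeft z w p.1) (paramDerivRight z w p.2)) :=
    ⟨_, h.hasFDerivAt, fun p ↦ rfl⟩
  rw [hL.fderiv, hLp]

/-- The chart of the ambient manifold cancels, so hypotheses on `g` and `J` along the immersion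
become the coordinate hypotheses of `fderiv_warping_eq_zero`. -/
theorem coordForm_prodCoordMap (hi : MDifferentiable (𝓘(ℝ, E₁).prod 𝓘(ℝ, E₂)) 𝓘(ℝ, E) i)
    (b : ∀ x : M, TangentSpace 𝓘(ℝ, E) x →L[ℝ] TangentSpace 𝓘(ℝ, E) x →L[ℝ] ℝ)
    {z : M₁ × M₂} {w : E₁ × E₂}
    (h1 : w.1 ∈ (extChartAt 𝓘(ℝ, E₁) z.1).target) (h2 : w.2 ∈ (extChartAt 𝓘(ℝ, E₂) z.2).target)
    (h3 : i (prodParam z w) ∈ (extChartAt 𝓘(ℝ, E) (i z)).source) (p q : E₁ × E₂) :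
    coordForm b (i z) (prodCoordMap E E₁ E₂ i z w) (fderiv ℝ (prodCoordMap E E₁ E₂ i z) w p)
      (fderiv ℝ (prodCoordMap E E₁ E₂ i z) w q) = b (i (prodParam z w))
      (prodDeriv E E₁ E₂ i (prodParam z w) (paramDerivLeft z w p.1) (paramDerivRight z w p.2))
      (prodDeriv E E₁ E₂ i (prodParam z w) (paramDerivLeft z w q.1) (paramDerivRight z w q.2)) := by
  rw [coordForm_eq_coordField b (y := prodCoordMap E E₁ E₂ i z w)
    ((extChartAt 𝓘(ℝ, E) (i z)).map_source h3),
    show (extChartAt 𝓘(ℝ, E) (i z)).symm (prodCoordMap E E₁ E₂ i z w) = i (prodParam z w) from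
    (extChartAt 𝓘(ℝ, E) (i z)).left_inv h3, fderiv_prodCoordMap hi h1 h2 h3,
    fderiv_prodCoordMap hi h1 h2 h3, coordField_chartDeriv h3, coordField_chartDeriv h3]

end Chart

end WarpedProducts

/-! ### Derivatives of the warping function -/

section Derivatives

variable {E₁ : Type*} [NormedAddCommGroup E₁] [NormedSpace ℝ E₁]
  {M₁ : Type*} [TopologicalSpace M₁] [ChartedSpace E₁ M₁]
  {E₂ : Type*} [NormedAddCommGroup E₂] [NormedSpace ℝ E₂]
  {M₂ : Type*} [TopologicalSpace M₂] [ChartedSpace E₂ M₂] {f : M₁ → ℝ}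

theorem mvfderiv_log_comp_fst (hf : MDifferentiable 𝓘(ℝ, E₁) 𝓘(ℝ, ℝ) f) (hf_pos : ∀ x, 0 < f x)
    (z : M₁ × M₂) (X : TangentSpace (𝓘(ℝ, E₁).prod 𝓘(ℝ, E₂)) z) :
    mvfderiv (𝓘(ℝ, E₁).prod 𝓘(ℝ, E₂)) (fun w : M₁ × M₂ ↦ Real.log (f w.1)) z X =
      (f z.1)⁻¹ * mvfderiv 𝓘(ℝ, E₁) f z.1
        (mfderiv (𝓘(ℝ, E₁).prod 𝓘(ℝ, E₂)) 𝓘(ℝ, E₁) Prod.fst z X) := by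
  have h := (Real.hasDerivAt_log (hf_pos z.1).ne').hasFDerivAt.hasMFDerivAt.comp z
    ((hf z.1).hasMFDerivAt.comp z
      (mdifferentiableAt_fst (I := 𝓘(ℝ, E₁)) (I' := 𝓘(ℝ, E₂))).hasMFDerivAt)
  have h' := congr($h.mfderiv X)
  exact h'.trans (Eq.trans (b := mvfderiv 𝓘(ℝ, E₁) f z.1
    (mfderiv (𝓘(ℝ, E₁).prod 𝓘(ℝ, E₂)) 𝓘(ℝ, E₁) Prod.fst z X) * (f z.1)⁻¹) rfl (mul_comm _ _))

theorem fderiv_comp_extChartAt_symm [IsManifold 𝓘(ℝ, E₁) ∞ M₁]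
    (hf : MDifferentiable 𝓘(ℝ, E₁) 𝓘(ℝ, ℝ) f) (x : M₁) :
    DifferentiableAt ℝ (f ∘ (extChartAt 𝓘(ℝ, E₁) x).symm) (extChartAt 𝓘(ℝ, E₁) x x) ∧ ∀ c : E₁,
    fderiv ℝ (f ∘ (extChartAt 𝓘(ℝ, E₁) x).symm) (extChartAt 𝓘(ℝ, E₁) x x) c =
      mvfderiv 𝓘(ℝ, E₁) f x (coordField x c x) := by
  have h2 : ∀ {y : E₁}, y ∈ (extChartAt 𝓘(ℝ, E₁) x).target →
      DifferentiableAt ℝ (f ∘ (extChartAt 𝓘(ℝ, E₁) x).symm) y ∧ ∀ c : E₁,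
      fderiv ℝ (f ∘ (extChartAt 𝓘(ℝ, E₁) x).symm) y c =
        mvfderiv 𝓘(ℝ, E₁) f ((extChartAt 𝓘(ℝ, E₁) x).symm y)
          (coordField x c ((extChartAt 𝓘(ℝ, E₁) x).symm y)) := fun {y} hy ↦ by
    have hs := (contMDiffAt_extChartAt_symm hy).mdifferentiableAt (by simp)
    refine ⟨((hf _).comp y hs).differentiableAt, fun c ↦ ?_⟩
    rw [coordField_extChartAt_symm hy, ← mfderiv_eq_fderiv]
    exact mfderiv_comp_apply y (hf _) hs c
  have h3 := h2 (mem_extChartAt_target (I := 𝓘(ℝ, E₁)) x)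
  rw [extChartAt_to_inv] at h3
  exact h3

end Derivatives

/-! ### Vanishing of the derivative of the warping function -/

section Main

variable {E : Type*} [NormedAddCommGroup E] [NormedSpace ℝ E] [FiniteDimensional ℝ E]
  {M : Type*} [TopologicalSpace M] [ChartedSpace E M] [IsManifold 𝓘(ℝ, E) ∞ M]
  [RiemannianBundle (fun x : M ↦ TangentSpace 𝓘(ℝ, E) x)]
  [IsContMDiffRiemannianBundle 𝓘(ℝ, E) ∞ E (fun x : M ↦ TangentSpace 𝓘(ℝ, E) x)]
  {E₁ : Type*} [NormedAddCommGroup E₁] [NormedSpace ℝ E₁]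
  {M₁ : Type*} [TopologicalSpace M₁] [ChartedSpace E₁ M₁] [IsManifold 𝓘(ℝ, E₁) ∞ M₁]
  [RiemannianBundle (fun x : M₁ ↦ TangentSpace 𝓘(ℝ, E₁) x)]
  {E₂ : Type*} [NormedAddCommGroup E₂] [NormedSpace ℝ E₂] [Nontrivial E₂]
  {M₂ : Type*} [TopologicalSpace M₂] [ChartedSpace E₂ M₂] [IsManifold 𝓘(ℝ, E₂) ∞ M₂]
  [RiemannianBundle (fun x : M₂ ↦ TangentSpace 𝓘(ℝ, E₂) x)]
  {f : M₁ → ℝ} {J : ∀ x : M, TangentSpace 𝓘(ℝ, E) x →L[ℝ] TangentSpace 𝓘(ℝ, E) x}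
  {i : M₁ × M₂ → M}

/-- The warping function of a semi-invariant warped product in a locally metallic manifold is
constant in the directions `J u`, for `u` tangent to the invariant factor. -/
theorem mvfderiv_warping_eq_zero {p q : ℕ}
    (hf : ContMDiff 𝓘(ℝ, E₁) 𝓘(ℝ, ℝ) ∞ f) (hf_pos : ∀ x, 0 < f x)
    (hi : ContMDiff (𝓘(ℝ, E₁).prod 𝓘(ℝ, E₂)) 𝓘(ℝ, E) ∞ i)
    (hi_isom : IsWarpedProductIsometric 𝓘(ℝ, E) 𝓘(ℝ, E₁) 𝓘(ℝ, E₂) f i)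
    (hi_semi : IsSemiInvariantProduct 𝓘(ℝ, E) 𝓘(ℝ, E₁) 𝓘(ℝ, E₂) J i)
    (hJ : IsLocallyMetallic p q J) (z : M₁ × M₂) (u u' : TangentSpace 𝓘(ℝ, E₁) z.1)
    (hu : J (i z) (prodDeriv E E₁ E₂ i z u 0) = prodDeriv E E₁ E₂ i z u' 0) :
    mvfderiv 𝓘(ℝ, E₁) f z.1 u' = 0 := by
  obtain ⟨hmet, nabla, hLC, hpar⟩ := hJ
  have hid := hi.mdifferentiable (by simp)
  have hfd := hf.mdifferentiable (by simp)
  obtain ⟨b, hb⟩ := exists_ne (0 : E₂)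
  have hm := mem_extChartAt_source (I := 𝓘(ℝ, E₁)) z.1
  set a : E₁ := chartDeriv z.1 z.1 u with ha
  set c : E₁ := chartDeriv z.1 z.1 u' with hc
  have hua : coordField z.1 a z.1 = u := coordField_chartDeriv hm u
  have huc : coordField z.1 c z.1 = u' := coordField_chartDeriv hm u'
  have hev := eventually_mem_chart E E₁ E₂ hi.continuous z
  obtain ⟨k1, k2, k3⟩ := hev.self_of_nhds
  have hF0 : prodCoordMap E E₁ E₂ i z (prodCoord E₁ E₂ z) = extChartAt 𝓘(ℝ, E) (i z) (i z) := by
    rw [prodCoordMap, prodParam_prodCoord]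
  obtain ⟨hφ, hφc⟩ := fderiv_comp_extChartAt_symm hfd z.1
  rw [← huc, ← hφc]
  -- Here `φ` is `f` in the chart, and `h` is the squared `g₂`-length of the coordinate vector `b`,
  -- nonzero because the chart differential is injective.
  refine fderiv_warping_eq_zero (christoffel_comm hLC (i z)) (F := prodCoordMap E E₁ E₂ i z)
    (z := prodCoord E₁ E₂ z) ((contDiffAt_prodCoordMap hi z).of_le (by norm_cast))
    (G := coordForm metricForm (i z)) (B := coordForm (tensorForm J) (i z)) (a := a) (b := b)
    (h := fun y ↦ inner ℝ (chartSymmDeriv z.2 y b) (chartSymmDeriv z.2 y b))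
    (by rw [hF0]; exact isParallelFormAt_metric hLC _)
    (by rw [hF0]; exact isParallelFormAt_tensor hLC hmet.contMDiff hpar _)
    (fun v w ↦ ?_) (fun v w ↦ ?_) hφ (hf_pos _).ne' ?_ ?_ ?_ ?_ ?_ ?_
  · simp only [coordForm_apply, metricForm_apply]
    exact real_inner_comm _ _
  · simp only [coordForm_apply, tensorForm_apply]
    rw [hmet.compatible]
    exact real_inner_comm _ _
  · refine inner_self_ne_zero.2 fun h0 ↦ hb ?_
    rw [← chartDeriv_chartSymmDeriv k2 b, h0, map_zero]
  · filter_upwards [hev] with w ⟨h1, h2, h3⟩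
    rw [coordForm_prodCoordMap hid _ h1 h2 h3, metricForm_apply, hi_isom.inner_prodDeriv]
    simp
  · filter_upwards [hev] with w ⟨h1, h2, h3⟩
    rw [coordForm_prodCoordMap hid _ h1 h2 h3, metricForm_apply, hi_isom.inner_prodDeriv]
    simp only [map_zero, inner_zero_left, zero_add]
    rfl
  · filter_upwards [hev] with w ⟨h1, h2, h3⟩
    rw [coordForm_prodCoordMap hid _ h1 h2 h3, tensorForm_apply]
    simp only [map_zero]
    obtain ⟨v, hv⟩ := hi_semi.exists_prodDeriv_left hid (prodParam z w) (paramDerivLeft z w a)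
    rw [hv, hi_isom.inner_prodDeriv]
    simp
  · filter_upwards [hev] with w ⟨h1, h2, h3⟩
    rw [coordForm_prodCoordMap hid _ h1 h2 h3, tensorForm_apply]
    simp only [map_zero]
    exact hi_semi.inner_prodDeriv_right hid _ _ _
  · intro v
    -- The parametrization returns `z` only up to propositional equality, so the relation `J∂_a =
    -- ∂_c` is stated for any `z' = z` and then transported.
    have aux : ∀ z' : M₁ × M₂, z' = z →
        J (i z') (prodDeriv E E₁ E₂ i z' (coordField z.1 a z'.1) 0) =
          prodDeriv E E₁ E₂ i z' (coordField z.1 c z'.1) 0 := by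
      rintro _ rfl
      rw [hua, huc, hu]
    have aux' := aux _ (prodParam_prodCoord (E₁ := E₁) (E₂ := E₂) z)
    have hpl (a : E₁) : coordField z.1 a (prodParam z (prodCoord E₁ E₂ z)).1 =
        paramDerivLeft z (prodCoord E₁ E₂ z) a := coordField_extChartAt_symm k1 a
    rw [hpl, hpl] at aux'
    have hsymm : (extChartAt 𝓘(ℝ, E) (i z)).symm
        (prodCoordMap E E₁ E₂ i z (prodCoord E₁ E₂ z)) = i (prodParam z (prodCoord E₁ E₂ z)) :=
      (extChartAt 𝓘(ℝ, E) (i z)).left_inv k3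
    have hy := (extChartAt 𝓘(ℝ, E) (i z)).map_source k3
    rw [coordForm_eq_coordField _ (y := prodCoordMap E E₁ E₂ i z (prodCoord E₁ E₂ z)) hy,
      coordForm_eq_coordField _ (y := prodCoordMap E E₁ E₂ i z (prodCoord E₁ E₂ z)) hy, hsymm,
      fderiv_prodCoordMap hid k1 k2 k3, fderiv_prodCoordMap hid k1 k2 k3,
      coordField_chartDeriv k3, coordField_chartDeriv k3, tensorForm_apply, metricForm_apply]
    simp only [map_zero]
    rw [aux']

/-- With `u' = Ju`, both `u'` and `p u' + q u = Ju'` are images under `J`, so `df` kills both and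
hence `q u`. -/
theorem mvfderiv_warping_eq_zero_of_isLocallyMetallic {p q : ℕ}
    (hf : ContMDiff 𝓘(ℝ, E₁) 𝓘(ℝ, ℝ) ∞ f) (hf_pos : ∀ x, 0 < f x)
    (hi : IsSmoothImmersion 𝓘(ℝ, E) (𝓘(ℝ, E₁).prod 𝓘(ℝ, E₂)) i)
    (hi_isom : IsWarpedProductIsometric 𝓘(ℝ, E) 𝓘(ℝ, E₁) 𝓘(ℝ, E₂) f i)
    (hi_semi : IsSemiInvariantProduct 𝓘(ℝ, E) 𝓘(ℝ, E₁) 𝓘(ℝ, E₂) J i)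
    (hJ : IsLocallyMetallic p q J) (z : M₁ × M₂) (u : TangentSpace 𝓘(ℝ, E₁) z.1) :
    mvfderiv 𝓘(ℝ, E₁) f z.1 u = 0 := by
  have hid := hi.contMDiff.mdifferentiable (by simp)
  have key := mvfderiv_warping_eq_zero hf hf_pos hi.contMDiff hi_isom hi_semi hJ z
  obtain ⟨u', hu'⟩ := hi_semi.exists_prodDeriv_left hid z u
  have hlin : prodDeriv E E₁ E₂ i z ((p : ℝ) • u' + (q : ℝ) • u) 0 =
      (p : ℝ) • prodDeriv E E₁ E₂ i z u' 0 + (q : ℝ) • prodDeriv E E₁ E₂ i z u 0 := by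
    have h (U V : TangentSpace (𝓘(ℝ, E₁).prod 𝓘(ℝ, E₂)) z) :
        mfderiv (𝓘(ℝ, E₁).prod 𝓘(ℝ, E₂)) 𝓘(ℝ, E) i z ((p : ℝ) • U + (q : ℝ) • V) =
        (p : ℝ) • mfderiv (𝓘(ℝ, E₁).prod 𝓘(ℝ, E₂)) 𝓘(ℝ, E) i z U +
        (q : ℝ) • mfderiv (𝓘(ℝ, E₁).prod 𝓘(ℝ, E₂)) 𝓘(ℝ, E) i z V := by simp
    refine Eq.trans ?_ (h (show E₁ × E₂ from (u', (0 : E₂))) (show E₁ × E₂ from (u, (0 : E₂))))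
    have h0 : (show E₁ × E₂ from ((p : ℝ) • u' + (q : ℝ) • u, (0 : E₂))) =
      (p : ℝ) • (show E₁ × E₂ from (u', (0 : E₂))) +
        (q : ℝ) • (show E₁ × E₂ from (u, (0 : E₂))) := Prod.ext rfl (by simp)
    exact congrArg (mfderiv (𝓘(ℝ, E₁).prod 𝓘(ℝ, E₂)) 𝓘(ℝ, E) i z) h0
  have h2 : J (i z) (prodDeriv E E₁ E₂ i z u' 0) =
      prodDeriv E E₁ E₂ i z ((p : ℝ) • u' + (q : ℝ) • u) 0 := by
    rw [hlin, ← hu', hJ.1.sq_eq]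
  have h3 := key _ _ h2
  rw [map_add, map_smul, map_smul, key _ _ hu', smul_zero, zero_add, smul_eq_mul] at h3
  have hq : (q : ℝ) ≠ 0 := by exact_mod_cast hJ.1.pos_right.ne'
  exact (mul_eq_zero.1 h3).resolve_left hq

end Main

end

theorem propositionp1
    -- the ambient manifold
    {E : Type*} [NormedAddCommGroup E] [NormedSpace ℝ E] [FiniteDimensional ℝ E]
    {M : Type*} [TopologicalSpace M] [ChartedSpace E M] [IsManifold 𝓘(ℝ, E) ∞ M]
    [RiemannianBundle (fun x : M ↦ TangentSpace 𝓘(ℝ, E) x)]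
    [IsContMDiffRiemannianBundle 𝓘(ℝ, E) ∞ E (fun x : M ↦ TangentSpace 𝓘(ℝ, E) x)]
    -- the base of the warped product
    {E₁ : Type*} [NormedAddCommGroup E₁] [NormedSpace ℝ E₁] [FiniteDimensional ℝ E₁]
    {M₁ : Type*} [TopologicalSpace M₁] [ChartedSpace E₁ M₁] [IsManifold 𝓘(ℝ, E₁) ∞ M₁]
    [RiemannianBundle (fun x : M₁ ↦ TangentSpace 𝓘(ℝ, E₁) x)]
    [IsContMDiffRiemannianBundle 𝓘(ℝ, E₁) ∞ E₁ (fun x : M₁ ↦ TangentSpace 𝓘(ℝ, E₁) x)]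
    -- the fiber of the warped product, of positive dimension
    {E₂ : Type*} [NormedAddCommGroup E₂] [NormedSpace ℝ E₂] [FiniteDimensional ℝ E₂]
    [Nontrivial E₂]
    {M₂ : Type*} [TopologicalSpace M₂] [ChartedSpace E₂ M₂] [IsManifold 𝓘(ℝ, E₂) ∞ M₂]
    [RiemannianBundle (fun x : M₂ ↦ TangentSpace 𝓘(ℝ, E₂) x)]
    [IsContMDiffRiemannianBundle 𝓘(ℝ, E₂) ∞ E₂ (fun x : M₂ ↦ TangentSpace 𝓘(ℝ, E₂) x)]
    (f : M₁ → ℝ) (hf : ContMDiff 𝓘(ℝ, E₁) 𝓘(ℝ, ℝ) ∞ f) (hf_pos : ∀ x, 0 < f x)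
    (J : ∀ x : M, TangentSpace 𝓘(ℝ, E) x →L[ℝ] TangentSpace 𝓘(ℝ, E) x)
    (i : M₁ × M₂ → M)
    (hi : IsSmoothImmersion 𝓘(ℝ, E) (𝓘(ℝ, E₁).prod 𝓘(ℝ, E₂)) i)
    (hi_isom : IsWarpedProductIsometric 𝓘(ℝ, E) 𝓘(ℝ, E₁) 𝓘(ℝ, E₂) f i)
    (hi_semi : IsSemiInvariantProduct 𝓘(ℝ, E) 𝓘(ℝ, E₁) 𝓘(ℝ, E₂) J i) :
    (∀ p q : ℕ, IsLocallyMetallic p q J →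
      ∀ (z : M₁ × M₂) (X : TangentSpace (𝓘(ℝ, E₁).prod 𝓘(ℝ, E₂)) z),
        -- `X` is tangent to the first factor
        mfderiv (𝓘(ℝ, E₁).prod 𝓘(ℝ, E₂)) 𝓘(ℝ, E₂) Prod.snd z X = 0 →
        mvfderiv (𝓘(ℝ, E₁).prod 𝓘(ℝ, E₂)) (fun w : M₁ × M₂ ↦ Real.log (f w.1)) z
            (tangentialOperator 𝓘(ℝ, E) (𝓘(ℝ, E₁).prod 𝓘(ℝ, E₂)) J hi z X) =
          -((q : ℝ) / (p : ℝ)) *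
            mvfderiv (𝓘(ℝ, E₁).prod 𝓘(ℝ, E₂)) (fun w : M₁ × M₂ ↦ Real.log (f w.1)) z X) ∧
    (IsLocallyGolden J →
      ∀ (z : M₁ × M₂) (X : TangentSpace (𝓘(ℝ, E₁).prod 𝓘(ℝ, E₂)) z),
        mfderiv (𝓘(ℝ, E₁).prod 𝓘(ℝ, E₂)) 𝓘(ℝ, E₂) Prod.snd z X = 0 →
        mvfderiv (𝓘(ℝ, E₁).prod 𝓘(ℝ, E₂)) (fun w : M₁ × M₂ ↦ Real.log (f w.1)) z
            (tangentialOperator 𝓘(ℝ, E) (𝓘(ℝ, E₁).prod 𝓘(ℝ, E₂)) J hi z X) =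
          -mvfderiv (𝓘(ℝ, E₁).prod 𝓘(ℝ, E₂)) (fun w : M₁ × M₂ ↦ Real.log (f w.1)) z X) := by
  -- Since `df = 0`, the differential of `ln f` vanishes on every tangent vector, and both claims
  -- read `0 = 0`.
  have key (p q : ℕ) (hJ : IsLocallyMetallic p q J) (z : M₁ × M₂)
      (Y : TangentSpace (𝓘(ℝ, E₁).prod 𝓘(ℝ, E₂)) z) :
      mvfderiv (𝓘(ℝ, E₁).prod 𝓘(ℝ, E₂)) (fun w : M₁ × M₂ ↦ Real.log (f w.1)) z Y = 0 := by
    rw [mvfderiv_log_comp_fst (hf.mdifferentiable (by simp)) hf_pos,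
      mvfderiv_warping_eq_zero_of_isLocallyMetallic hf hf_pos hi hi_isom hi_semi hJ, mul_zero]
  refine ⟨fun p q hJ z X _ ↦ ?_, fun hJ z X _ ↦ ?_⟩
  · rw [key p q hJ, key p q hJ, mul_zero]
  · rw [key 1 1 hJ, key 1 1 hJ, neg_zero]
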